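/- Let $\phi:\mathbb{B}^n\to\mathbb{B}^n$ be an analytic self-map of the open unit ball of $\mathbb{C}^n$ with $\phi(0)=0$ and with $\phi'(0)$ invertible. Suppose that $\phi$ is not unitary on any slice, that is, there are no unit vectors $\zeta,\eta\in\mathbb{C}^n$ with $\phi(c\zeta)=c\eta$ for all $c\in\mathbb{C}$, $|c|<1$. Let $G:[0,1)\to(0,\infty)$ be a continuous, non-increasing function such that the composition operator $C_\phi f=f\circ\phi$ is (well defined and) compact on the weighted Bergman space $A_G^2(\mathbb{B}^n)$ of analytic functions $f$ on $\mathbb{B}^n$ with $\|f\|^2=\int_{\mathbb{B}^n}|f(z)|^2G(|z|)\,dz<\infty$, where $dz$ is Lebesgue measure. For an integer $K\ge 0$ let $H_1=\langle z^\alpha:|\alpha|\le K\rangle\subset A_G^2(\mathbb{B}^n)$, let $H_2$ be the orthogonal complement of $H_1$, and let $U$ and $W$ be the compressions of $C_\phi$ to $H_1$ and $H_2$. Let $\mu$ be a resonant eigenvalue of $\phi'(0)$, that is, an eigenvalue of $\phi'(0)$ which is also a product of at least two eigenvalues of $\phi'(0)$ (repetitions allowed), and let $K$ be large enough that $\mu\notin\sigma(W)$.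 Let $T_\mu$ be the generalized eigenspace of $\phi'(0)^t$ for $\mu$, let $d=\dim T_\mu$, and let $L_\mu$ be the $d\times d$ matrix of the restriction of $\phi'(0)^t$ to $T_\mu$ in any basis of $T_\mu$ (for instance, a basis in which it is in Jordan form). If $$\dim\ker(U-\mu I)=\dim\ker(\phi'(0)^t-\mu I),$$ then there is no full rank solution $F_\mu$, that is, there is no analytic $F_\mu:\mathbb{B}^n\to\mathbb{C}^d$ with $F_\mu\circ\phi=L_\mu^t F_\mu$ on $\mathbb{B}^n$ whose derivative $F_\mu'(0)$ has full rank $d$. -/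

import Mathlib

open MeasureTheory Metric

noncomputable section

/-- `ℂⁿ` with the Euclidean norm. -/
abbrev Cn (n : ℕ) : Type := EuclideanSpace ℂ (Fin n)

/-- The open unit ball `𝔹ⁿ` of `ℂⁿ`. -/
abbrev unitBall (n : ℕ) : Set (Cn n) := ball 0 1

/-- A continuous, non-increasing weight `G : [0,1) → (0,∞)`; only the values on `[0,1)` matter. -/
structure RadialWeight where
  toFun : ℝ → ℝ
  continuousOn : ContinuousOn toFun (Set.Ico 0 1)
  antitoneOn : AntitoneOn toFun (Set.Ico 0 1)
  pos : ∀ r ∈ Set.Ico (0 : ℝ) 1, 0 < toFun r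

/-- The measure `G(|z|) dz` on the unit ball, where `dz` is Lebesgue measure on `ℂⁿ = ℝ²ⁿ`. -/
def weightedMeasure (n : ℕ) (G : RadialWeight) : Measure (Cn n) :=
  (volume.restrict (unitBall n)).withDensity (fun z => ENNReal.ofReal (G.toFun ‖z‖))

/-- The functions of `A²_G(𝔹ⁿ)`: analytic on the ball, with `∫ |f(z)|² G(|z|) dz < ∞`.  A function
on the ball is represented by its extension by zero to `ℂⁿ`. -/
def bergmanSubmodule (n : ℕ) (G : RadialWeight) : Submodule ℂ (Cn n → ℂ) where
  carrier := {f | AnalyticOnNhd ℂ f (unitBall n) ∧ (∀ z ∉ unitBall n, f z = 0) ∧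
    MemLp f 2 (weightedMeasure n G)}
  zero_mem' := ⟨fun _ _ => analyticAt_const, fun _ _ => rfl, MemLp.zero⟩
  add_mem' := by
    rintro f g ⟨hf, hf0, hfL⟩ ⟨hg, hg0, hgL⟩
    exact ⟨hf.add hg, fun z hz => by simp [hf0 z hz, hg0 z hz], hfL.add hgL⟩
  smul_mem' := by
    rintro c f ⟨hf, hf0, hfL⟩
    exact ⟨fun z hz => analyticAt_const.smul (hf z hz), fun z hz => by simp [hf0 z hz],
      hfL.const_smul c⟩

/-- The weighted Bergman space `A²_G(𝔹ⁿ)`. -/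
def BergmanSpace (n : ℕ) (G : RadialWeight) : Type := ↥(bergmanSubmodule n G)

namespace BergmanSpace

variable {n : ℕ} {G : RadialWeight}

instance : AddCommGroup (BergmanSpace n G) :=
  inferInstanceAs (AddCommGroup ↥(bergmanSubmodule n G))

instance : Module ℂ (BergmanSpace n G) :=
  inferInstanceAs (Module ℂ ↥(bergmanSubmodule n G))

instance : CoeFun (BergmanSpace n G) (fun _ => Cn n → ℂ) := ⟨fun f => f.1⟩

/-- The inclusion of `A²_G(𝔹ⁿ)` in `L²(𝔹ⁿ, G(|z|) dz)`. -/
def toL2 (n : ℕ) (G : RadialWeight) :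
    BergmanSpace n G →ₗ[ℂ] Lp ℂ 2 (weightedMeasure n G) where
  toFun f := MemLp.toLp f.1 f.2.2.2
  map_add' _ _ := rfl
  map_smul' _ _ := rfl

theorem toL2_injective : Function.Injective (toL2 n G) := by
  intro f g hfg
  have h1 : f.1 =ᵐ[weightedMeasure n G] g.1 := (MemLp.toLp_eq_toLp_iff f.2.2.2 g.2.2.2).1 hfg
  have hmeas : AEMeasurable (fun z : Cn n => ENNReal.ofReal (G.toFun ‖z‖))
      (volume.restrict (unitBall n)) := by
    refine ENNReal.measurable_ofReal.comp_aemeasurable ?_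
    refine ContinuousOn.aemeasurable ?_ measurableSet_ball
    exact G.continuousOn.comp continuous_norm.continuousOn
      (fun z hz => ⟨norm_nonneg z, by simpa using hz⟩)
  have hac : volume.restrict (unitBall n) ≪ weightedMeasure n G := by
    refine withDensity_absolutelyContinuous' hmeas ?_
    refine (ae_restrict_iff' measurableSet_ball).2 (Filter.Eventually.of_forall fun z hz => ?_)
    have := G.pos ‖z‖ ⟨norm_nonneg z, by simpa using hz⟩
    simpa using this
  have h2 : Set.EqOn f.1 g.1 (unitBall n) :=
    Measure.eqOn_open_of_ae_eq (hac.ae_le h1) isOpen_ball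
      f.2.1.continuousOn g.2.1.continuousOn
  refine Subtype.ext (funext fun z => ?_)
  by_cases hz : z ∈ unitBall n
  · exact h2 hz
  · rw [f.2.2.1 z hz, g.2.2.1 z hz]

instance : NormedAddCommGroup (BergmanSpace n G) :=
  NormedAddCommGroup.induced _ _ (toL2 n G) toL2_injective

/-- The inner product of `A²_G(𝔹ⁿ)` is that of `L²(𝔹ⁿ, G(|z|) dz)`. -/
instance : InnerProductSpace ℂ (BergmanSpace n G) where
  norm_smul_le c f := by
    change ‖toL2 n G (c • f)‖ ≤ ‖c‖ * ‖toL2 n G f‖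
    rw [map_smul]; exact norm_smul_le _ _
  inner f g := inner ℂ (toL2 n G f) (toL2 n G g)
  norm_sq_eq_re_inner f := norm_sq_eq_re_inner (toL2 n G f)
  conj_inner_symm f g := inner_conj_symm _ _
  add_left f g h := by rw [map_add]; exact inner_add_left _ _ _
  smul_left f g c := by rw [map_smul]; exact inner_smul_left _ _ _

/-- The span `⟨z^α : |α| ≤ K⟩` in `A²_G(𝔹ⁿ)`. -/
def monomialSpan (n : ℕ) (G : RadialWeight) (K : ℕ) : Submodule ℂ (BergmanSpace n G) :=
  Submodule.span ℂ {f | ∃ α : Fin n → ℕ, ∑ i, α i ≤ K ∧ ∀ z ∈ unitBall n, f z = ∏ i, z i ^ α i}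

instance (K : ℕ) : FiniteDimensional ℂ (monomialSpan n G K) := by
  refine FiniteDimensional.span_of_finite ℂ ?_
  have hfin : Set.Finite {α : Fin n → ℕ | ∑ i, α i ≤ K} :=
    (Set.finite_Iic (fun _ : Fin n => K)).subset fun α hα i =>
      (Finset.single_le_sum (f := α) (fun _ _ => Nat.zero_le _) (Finset.mem_univ i)).trans hα
  refine (hfin.biUnion (t := fun α => {f : BergmanSpace n G |
    ∀ z ∈ unitBall n, f z = ∏ i, z i ^ α i}) fun α _ => ?_).subset ?_
  · refine Set.Subsingleton.finite fun f hf g hg => Subtype.ext (funext fun z => ?_)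
    by_cases hz : z ∈ unitBall n
    · exact (hf z hz).trans (hg z hz).symm
    · exact (f.2.2.1 z hz).trans (g.2.2.1 z hz).symm
  · rintro f ⟨α, hα, hf⟩
    exact Set.mem_biUnion hα hf

/-- The composition `f ∘ φ` of functions on the ball, extended by zero. -/
def compBall (φ : Cn n → Cn n) (f : Cn n → ℂ) : Cn n → ℂ := (unitBall n).indicator (f ∘ φ)

/-- The composition operator `C_φ f = f ∘ φ` on `A²_G(𝔹ⁿ)`, when it maps this space to itself. -/
def compositionOperator (φ : Cn n → Cn n)
    (hφ : ∀ f ∈ bergmanSubmodule n G, compBall φ f ∈ bergmanSubmodule n G) :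
    BergmanSpace n G →ₗ[ℂ] BergmanSpace n G where
  toFun f := ⟨compBall φ f.1, hφ f.1 f.2⟩
  map_add' f g := Subtype.ext (Set.indicator_add (unitBall n) (f.1 ∘ φ) (g.1 ∘ φ))
  map_smul' c f := Subtype.ext (Set.indicator_const_smul (unitBall n) c (f.1 ∘ φ))

/-- `C_φ` is a (well-defined) compact operator on `A²_G(𝔹ⁿ)`. -/
structure IsCompactComposition (n : ℕ) (G : RadialWeight) (φ : Cn n → Cn n) : Prop where
  mapsTo : ∀ f ∈ bergmanSubmodule n G, compBall φ f ∈ bergmanSubmodule n G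
  isCompact : IsCompactOperator (compositionOperator φ mapsTo)

/-- `C_φ` as a bounded operator on `A²_G(𝔹ⁿ)`. -/
def compositionCLM {φ : Cn n → Cn n} (hφ : IsCompactComposition n G φ) :
    BergmanSpace n G →L[ℂ] BergmanSpace n G :=
  ⟨compositionOperator φ hφ.mapsTo, hφ.isCompact.continuous⟩

end BergmanSpace

/-- The compression of a bounded operator `C` to a subspace `S`: restrict `C` to `S`, then project
orthogonally to `S`. -/
def compression {H : Type*} [NormedAddCommGroup H] [InnerProductSpace ℂ H] (C : H →L[ℂ] H)
    (S : Submodule ℂ H) [S.HasOrthogonalProjection] : S →L[ℂ] S :=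
  S.orthogonalProjectionOnto ∘L C ∘L S.subtypeL

/-- The block `U` of `C_φ`: its compression to `⟨z^α : |α| ≤ K⟩`. -/
def blockU {n : ℕ} {G : RadialWeight} {φ : Cn n → Cn n}
    (hφ : BergmanSpace.IsCompactComposition n G φ) (K : ℕ) :
    BergmanSpace.monomialSpan n G K →L[ℂ] BergmanSpace.monomialSpan n G K :=
  compression (BergmanSpace.compositionCLM hφ) (BergmanSpace.monomialSpan n G K)

/-- The block `W` of `C_φ`: its compression to the orthogonal complement of `⟨z^α : |α| ≤ K⟩`. -/
def blockW {n : ℕ} {G : RadialWeight} {φ : Cn n → Cn n}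
    (hφ : BergmanSpace.IsCompactComposition n G φ) (K : ℕ) :
    (BergmanSpace.monomialSpan n G K)ᗮ →L[ℂ] (BergmanSpace.monomialSpan n G K)ᗮ :=
  compression (BergmanSpace.compositionCLM hφ) (BergmanSpace.monomialSpan n G K)ᗮ

/-- `φ` is unitary on the slice through some unit vector `ζ`: it maps the disc `{cζ : |c| < 1}` to
a disc `{cη : |c| < 1}`, `|η| = 1`, by `cζ ↦ cη`. -/
def UnitaryOnSlice {n : ℕ} (φ : Cn n → Cn n) : Prop :=
  ∃ ζ η : Cn n, ‖ζ‖ = 1 ∧ ‖η‖ = 1 ∧ ∀ c : ℂ, ‖c‖ < 1 → φ (c • ζ) = c • η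

/-- The matrix `φ'(0)`, with entries `∂φ_i/∂z_j (0)`. -/
def jacobianZero {n : ℕ} (φ : Cn n → Cn n) : Matrix (Fin n) (Fin n) ℂ :=
  Matrix.of fun i j => fderiv ℂ φ 0 (EuclideanSpace.single j 1) i

/-- `μ` is a resonant eigenvalue of the matrix `A`: an eigenvalue which is also a product of at
least two eigenvalues of `A`, repetitions allowed. -/
def IsResonantEigenvalue {n : ℕ} (A : Matrix (Fin n) (Fin n) ℂ) (μ : ℂ) : Prop :=
  Module.End.HasEigenvalue (Matrix.toLin' A) μ ∧
    ∃ s : Multiset ℂ, 2 ≤ s.card ∧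
      (∀ ν ∈ s, Module.End.HasEigenvalue (Matrix.toLin' A) ν) ∧ s.prod = μ

/-- The generalized eigenspace `T_μ` of the matrix `A`. -/
abbrev genEigenspace {n : ℕ} (A : Matrix (Fin n) (Fin n) ℂ) (μ : ℂ) :
    Submodule ℂ (Fin n → ℂ) :=
  Module.End.maxGenEigenspace (Matrix.toLin' A) μ

/-- The matrix of `A` restricted to its generalized eigenspace `T_μ`, in a basis `b` of `T_μ`.
It is a Jordan matrix when `b` is a Jordan basis. -/
def genEigenspaceMatrix {n d : ℕ} (A : Matrix (Fin n) (Fin n) ℂ) (μ : ℂ)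
    (b : Module.Basis (Fin d) ℂ (genEigenspace A μ)) : Matrix (Fin d) (Fin d) ℂ :=
  LinearMap.toMatrix b b ((Matrix.toLin' A).restrict
    (Module.End.mapsTo_maxGenEigenspace_of_comm (Commute.refl (Matrix.toLin' A)) μ))

/-- `F : 𝔹ⁿ → ℂᵈ` is a full rank solution of `F ∘ φ = Lᵗ F`: it is analytic on the ball, satisfies
the equation there, and its derivative at `0` has full rank `d`. -/
structure IsFullRankBlockSolution {n d : ℕ} (φ : Cn n → Cn n) (L : Matrix (Fin d) (Fin d) ℂ)
    (F : Cn n → Fin d → ℂ) : Prop where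
  analytic : AnalyticOnNhd ℂ F (unitBall n)
  equation : ∀ z ∈ unitBall n, F (φ z) = L.transpose.mulVec (F z)
  fullRank : Function.Surjective (fderiv ℂ F 0)

end

/-! Suppose `F` is a full rank solution. If `a` is the coordinate vector of an eigenvector of
`φ'(0)ᵗ` for `μ`, then `(a·F) ∘ φ = (L a)·F = μ (a·F)` on the ball. By full rank, `a·F` has nonzero
linear part when `a ≠ 0`. Hence the `K`-jets of these functions form a space of eigenvectors of `U`
of dimension `dim ker(φ'(0)ᵗ - μ)`, none of which, except 0, vanishes to order 2. Resonance supplies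
one more eigenvector of `U`, which does vanish to order 2, so `ker(U - μ)` is too large.

The analysis serves to describe the blocks algebraically. Rotation invariance of the measure makes
`H₂` exactly the functions vanishing to order greater than `K` (`mem_orthogonal_iff`). Composition
with `φ` preserves order of vanishing, so `U` is composition on `K`-jets (`blockU_jet`) and `W` is
the restriction of `C_φ` to `H₂` (`coe_blockW`).

For the extra eigenvector, multiply left eigenfunctionals of `φ'(0)` whose eigenvalues have product
`μ`. This gives `p`, homogeneous of degree `k ≥ 2`, with `p ∘ φ - μ p` of order greater than `k`. If
`k > K`, the class of `p` would be a kernel vector of `W - μ` on a finite-dimensional quotient,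
contradicting `μ ∉ σ(W)`. So `k ≤ K`, and terms of higher order correct `p` to a true eigenvector of
`U`, or such an eigenvector already exists among them. -/

noncomputable section

open Filter Topology Asymptotics

/-! ### Cauchy coefficients on the unit circle -/

/-- A power series of order greater than `j` has vanishing `j`-th Cauchy coefficient integral. -/
theorem circleIntegral_inv_pow_mul_eq_zero {R : ℝ} (hR : 1 < R) (j : ℕ) :
    ∀ {k : ℂ → ℂ}, DifferentiableOn ℂ k (ball 0 R) →
      k =O[𝓝[≠] 0] (fun c => c ^ (j + 1)) →
      (∮ c in C(0, 1), (c ^ (j + 1))⁻¹ * k c) = 0 := by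
  have hnhds : ball (0 : ℂ) R ∈ 𝓝 (0 : ℂ) := ball_mem_nhds _ (by linarith)
  have hlim : ∀ {k : ℂ → ℂ} (m : ℕ), DifferentiableOn ℂ k (ball 0 R) →
      k =O[𝓝[≠] 0] (fun c => c ^ (m + 1)) → k 0 = 0 := by
    intro k m hk hO
    have h1 : Tendsto k (𝓝[≠] 0) (𝓝 (k 0)) :=
      ((hk.differentiableAt hnhds).continuousAt.tendsto).mono_left nhdsWithin_le_nhds
    have h2 : Tendsto (fun c : ℂ => c ^ (m + 1)) (𝓝[≠] 0) (𝓝 0) := by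
      have : Tendsto (fun c : ℂ => c ^ (m + 1)) (𝓝 0) (𝓝 (0 ^ (m + 1))) :=
        (continuous_pow (m + 1)).tendsto 0
      simpa using this.mono_left nhdsWithin_le_nhds
    exact tendsto_nhds_unique h1 (hO.trans_tendsto h2)
  induction j with
  | zero =>
    intro k hk hO
    have h0 := hlim 0 hk hO
    have hd : DiffContOnCl ℂ k (ball 0 1) := by
      refine (hk.mono ?_).diffContOnCl
      rw [closure_ball _ one_ne_zero]
      exact closedBall_subset_ball hR
    have := hd.circleIntegral_sub_inv_smul (mem_ball_self one_pos)
    simpa [h0] using this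
  | succ j ih =>
    intro k hk hO
    have h0 := hlim (j + 1) hk hO
    -- Dividing by `c` lowers the order of `k` and the exponent in the kernel by one each; `dslope`
    -- makes the quotient analytic at `0`.
    have hq : DifferentiableOn ℂ (dslope k 0) (ball 0 R) :=
      (Complex.differentiableOn_dslope hnhds).2 hk
    have hval : ∀ c : ℂ, c ≠ 0 → dslope k 0 c = c⁻¹ * k c := fun c hc => by
      rw [dslope_of_ne _ hc, slope_def_field, h0]; field_simp; ring
    have hqO : dslope k 0 =O[𝓝[≠] 0] (fun c => c ^ (j + 1)) := by
      have h1 : (fun c : ℂ => c⁻¹ * k c) =O[𝓝[≠] 0] (fun c => c⁻¹ * c ^ (j + 1 + 1)) :=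
        (isBigO_refl _ _).mul hO
      refine h1.congr' ?_ ?_
      · filter_upwards [self_mem_nhdsWithin] with c hc using (hval c hc).symm
      · filter_upwards [self_mem_nhdsWithin] with c hc
        have : c ≠ 0 := hc
        field_simp
        ring
    refine Eq.trans ?_ (ih hq hqO)
    refine circleIntegral.integral_congr zero_le_one fun c hc => ?_
    have hc0 : c ≠ 0 := ne_of_mem_sphere hc one_ne_zero
    simp only [hval c hc0]
    field_simp
    ring

/-- In the angle, `dc = i c dθ` absorbs one factor of `c⁻¹`. -/
theorem integral_circleMap_inv_pow_mul_eq_zero {R : ℝ} (hR : 1 < R) (j : ℕ) {k : ℂ → ℂ}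
    (hk : DifferentiableOn ℂ k (ball 0 R)) (hO : k =O[𝓝[≠] 0] (fun c => c ^ (j + 1))) :
    (∫ θ in (0 : ℝ)..2 * Real.pi, (circleMap 0 1 θ ^ j)⁻¹ * k (circleMap 0 1 θ)) = 0 := by
  have h := circleIntegral_inv_pow_mul_eq_zero hR j hk hO
  rw [circleIntegral] at h
  have h2 : ∀ θ : ℝ, deriv (circleMap 0 1) θ •
      ((circleMap 0 1 θ ^ (j + 1))⁻¹ * k (circleMap 0 1 θ)) =
      Complex.I * ((circleMap 0 1 θ ^ j)⁻¹ * k (circleMap 0 1 θ)) := fun θ => by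
    have : circleMap 0 1 θ ≠ 0 := circleMap_ne_center one_ne_zero
    rw [deriv_circleMap, smul_eq_mul]
    field_simp
    ring
  simp only [h2, intervalIntegral.integral_const_mul] at h
  exact (mul_eq_zero.1 h).resolve_left Complex.I_ne_zero

/-! ### Rotation invariance and finiteness of the weighted measure -/

/-- Multiplication by a unimodular scalar, as a real linear isometry. -/
def unimodularSMul {n : ℕ} {c : ℂ} (hc : ‖c‖ = 1) : Cn n ≃ₗᵢ[ℝ] Cn n :=
  LinearIsometryEquiv.mk
    ((LinearEquiv.smulOfNeZero ℂ (Cn n) c (by rintro rfl; simp at hc)).restrictScalars ℝ)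
    (fun z => by
      change ‖c • z‖ = ‖z‖
      rw [norm_smul, hc, one_mul])

theorem measurePreserving_unimodularSMul {n : ℕ} (G : RadialWeight) {c : ℂ} (hc : ‖c‖ = 1) :
    MeasurePreserving (unimodularSMul (n := n) hc) (weightedMeasure n G) (weightedMeasure n G) := by
  have hemb : MeasurableEmbedding (unimodularSMul (n := n) hc) :=
    (unimodularSMul hc).toHomeomorph.measurableEmbedding
  have h1 : MeasurePreserving (unimodularSMul (n := n) hc) (volume.restrict (unitBall n))
      (volume.restrict (unitBall n)) := by
    have := (unimodularSMul (n := n) hc).measurePreserving.restrict_preimage_emb hemb (unitBall n)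
    have hpre : (unimodularSMul (n := n) hc) ⁻¹' unitBall n = unitBall n := by
      ext z; simp
    rwa [hpre] at this
  refine ⟨hemb.measurable, Measure.ext fun s hs => ?_⟩
  rw [Measure.map_apply hemb.measurable hs, weightedMeasure, withDensity_apply _ hs,
    withDensity_apply _ (hemb.measurable hs),
    ← h1.setLIntegral_comp_preimage_emb hemb (fun z => ENNReal.ofReal (G.toFun ‖z‖)) s]
  simp only [LinearIsometryEquiv.norm_map]

/-- The weight is at most `G 0`. Finiteness puts all polynomials in the Bergman space. -/
instance (n : ℕ) (G : RadialWeight) : IsFiniteMeasure (weightedMeasure n G) := by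
  refine ⟨?_⟩
  rw [weightedMeasure, withDensity_apply _ MeasurableSet.univ, Measure.restrict_univ]
  calc ∫⁻ z in unitBall n, ENNReal.ofReal (G.toFun ‖z‖)
      ≤ ∫⁻ _ in unitBall n, ENNReal.ofReal (G.toFun 0) := by
        refine setLIntegral_mono measurable_const fun z hz => ENNReal.ofReal_le_ofReal ?_
        exact G.antitoneOn ⟨le_rfl, one_pos⟩ ⟨norm_nonneg z, by simpa using hz⟩ (norm_nonneg z)
    _ < ⊤ := by
        rw [setLIntegral_const]
        exact ENNReal.mul_lt_top ENNReal.ofReal_lt_top measure_ball_lt_top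

theorem ae_mem_unitBall (n : ℕ) (G : RadialWeight) :
    ∀ᵐ z ∂weightedMeasure n G, z ∈ unitBall n :=
  (withDensity_absolutelyContinuous _ _).ae_le (ae_restrict_mem measurableSet_ball)

/-! ### Orthogonality by averaging over rotations -/

namespace BergmanSpace

variable {n : ℕ} {G : RadialWeight}

theorem eq_indicator (f : BergmanSpace n G) : (f : Cn n → ℂ) = (unitBall n).indicator f := by
  ext z
  by_cases hz : z ∈ unitBall n
  · simp [hz]
  · simp [hz, f.2.2.1 z hz]

theorem measurable (f : BergmanSpace n G) : Measurable (f : Cn n → ℂ) := by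
  classical
  rw [eq_indicator f, ← Set.piecewise_eq_indicator]
  exact f.2.1.continuousOn.measurable_piecewise continuousOn_const measurableSet_ball

theorem inner_eq_integral (f h : BergmanSpace n G) :
    inner ℂ f h = ∫ z, (starRingEnd ℂ) (f z) * h z ∂weightedMeasure n G := by
  change inner ℂ (toL2 n G f) (toL2 n G h) = _
  rw [L2.inner_def]
  refine integral_congr_ae ?_
  filter_upwards [MemLp.coeFn_toLp f.2.2.2, MemLp.coeFn_toLp h.2.2.2] with z h1 h2
  change inner ℂ ((MemLp.toLp f.1 f.2.2.2) z) ((MemLp.toLp h.1 h.2.2.2) z) = _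
  rw [h1, h2, RCLike.inner_apply, mul_comm]

theorem integrable_conj_mul (f h : BergmanSpace n G) :
    Integrable (fun z => (starRingEnd ℂ) (f z) * h z) (weightedMeasure n G) := by
  have := MemLp.integrable_mul (f.2.2.2.star) h.2.2.2
  exact this

/-- The hypothesis of Fubini: rotation does not change the integral of `‖g‖`, so the integral over
angles is that of a constant. -/
theorem integrable_prod_circleMap_smul {g : Cn n → ℂ} (hgm : Measurable g)
    (hint : Integrable g (weightedMeasure n G)) :
    Integrable (Function.uncurry fun (θ : ℝ) (z : Cn n) => g (circleMap 0 1 θ • z))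
      ((volume.restrict (Set.Ioc 0 (2 * Real.pi))).prod (weightedMeasure n G)) := by
  have hcirc : ∀ θ : ℝ, ‖circleMap 0 1 θ‖ = 1 := fun θ => by simp
  have hcont : Continuous fun p : ℝ × Cn n => circleMap 0 1 p.1 • p.2 :=
    ((continuous_circleMap 0 1).comp continuous_fst).smul continuous_snd
  have hmeas : Measurable fun p : ℝ × Cn n => g (circleMap 0 1 p.1 • p.2) :=
    hgm.comp hcont.measurable
  refine (integrable_prod_iff hmeas.aestronglyMeasurable).2
    ⟨Eventually.of_forall fun θ => ?_, ?_⟩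
  · exact (measurePreserving_unimodularSMul G (hcirc θ)).integrable_comp_of_integrable hint
  · have hrotn : ∀ θ : ℝ, ∫ z, ‖g (circleMap 0 1 θ • z)‖ ∂weightedMeasure n G =
        ∫ z, ‖g z‖ ∂weightedMeasure n G := fun θ =>
      (measurePreserving_unimodularSMul G (hcirc θ)).integral_comp
        (unimodularSMul (hcirc θ)).toHomeomorph.measurableEmbedding (fun z => ‖g z‖)
    exact (integrable_const _).congr (Eventually.of_forall fun θ => (hrotn θ).symm)

/-- A homogeneous function of degree `j` is orthogonal to the functions of higher order at `0`. -/
theorem inner_eq_zero_of_homogeneous (f h : BergmanSpace n G) (j : ℕ)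
    (hf : ∀ z ∈ unitBall n, ∀ c : ℂ, ‖c‖ = 1 → f (c • z) = c ^ j * f z)
    (hh : (h : Cn n → ℂ) =O[𝓝 0] (fun z => ‖z‖ ^ (j + 1))) : inner ℂ f h = 0 := by
  set g : Cn n → ℂ := fun z => (starRingEnd ℂ) (f z) * h z with hg
  have hcirc : ∀ θ : ℝ, ‖circleMap 0 1 θ‖ = 1 := fun θ => by simp
  have hgm : Measurable g := (Complex.continuous_conj.measurable.comp f.measurable).mul h.measurable
  have hrot : ∀ θ : ℝ, ∫ z, g (circleMap 0 1 θ • z) ∂weightedMeasure n G =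
      ∫ z, g z ∂weightedMeasure n G := fun θ =>
    (measurePreserving_unimodularSMul G (hcirc θ)).integral_comp
      (unimodularSMul (hcirc θ)).toHomeomorph.measurableEmbedding g
  have hint : Integrable g (weightedMeasure n G) := integrable_conj_mul f h
  have hprod := integrable_prod_circleMap_smul hgm hint
  have hswap := integral_integral_swap hprod
  -- The average over rotations equals the inner product up to the factor `2π`, so it suffices that
  -- each circle integral vanishes.
  simp only [hrot] at hswap
  have hinner : ∀ z ∈ unitBall n,
      ∫ θ in Set.Ioc 0 (2 * Real.pi), g (circleMap 0 1 θ • z) = 0 := by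
    intro z hz
    have hz1 : ‖z‖ < 1 := by simpa using hz
    -- The slice `c ↦ h (c • z)` is thus analytic beyond the closed unit disc.
    obtain ⟨R, hR1, hR⟩ : ∃ R : ℝ, 1 < R ∧ R * ‖z‖ < 1 := by
      rcases eq_or_ne ‖z‖ 0 with h0 | h0
      · exact ⟨2, by norm_num, by simp [h0]⟩
      · have hpos : 0 < ‖z‖ := lt_of_le_of_ne (norm_nonneg _) (Ne.symm h0)
        obtain ⟨R, hR1, hR2⟩ := exists_between ((one_lt_inv₀ hpos).2 hz1)
        exact ⟨R, hR1, by rwa [lt_inv_comm₀ (by linarith) hpos, ← one_div,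
          lt_div_iff₀ (by linarith), mul_comm] at hR2⟩
    have hmem : ∀ c ∈ ball (0 : ℂ) R, c • z ∈ unitBall n := fun c hc => by
      have hc' : ‖c‖ < R := by simpa using hc
      rw [mem_ball_zero_iff, norm_smul]
      exact (mul_le_mul_of_nonneg_right hc'.le (norm_nonneg _)).trans_lt hR
    have hk : DifferentiableOn ℂ (fun c : ℂ => h (c • z)) (ball 0 R) :=
      h.2.1.differentiableOn.comp
        ((differentiable_id.smul_const z).differentiableOn) hmem
    have hkO : (fun c : ℂ => h (c • z)) =O[𝓝[≠] 0] (fun c => c ^ (j + 1)) := by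
      have ht : Tendsto (fun c : ℂ => c • z) (𝓝[≠] 0) (𝓝 0) := by
        have : Tendsto (fun c : ℂ => c • z) (𝓝 0) (𝓝 ((0 : ℂ) • z)) :=
          (continuous_id.smul continuous_const).tendsto 0
        simpa using this.mono_left nhdsWithin_le_nhds
      refine (hh.comp_tendsto ht).trans (IsBigO.of_bound (‖z‖ ^ (j + 1)) ?_)
      refine Eventually.of_forall fun c => ?_
      simp [norm_smul, mul_pow, mul_comm]
    have hzero := integral_circleMap_inv_pow_mul_eq_zero hR1 j hk hkO
    rw [← intervalIntegral.integral_of_le Real.two_pi_pos.le]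
    -- Conjugation is inversion on the unit circle, which leaves the `j`-th Cauchy coefficient of
    -- the slice of `h`.
    have : ∀ θ : ℝ, g (circleMap 0 1 θ • z) = (starRingEnd ℂ) (f z) *
        ((circleMap 0 1 θ ^ j)⁻¹ * h (circleMap 0 1 θ • z)) := fun θ => by
      rw [hg]
      simp only
      rw [hf z hz _ (hcirc θ), map_mul, map_pow, ← Complex.inv_eq_conj (hcirc θ), inv_pow]
      ring
    simp only [this, intervalIntegral.integral_const_mul, hzero, mul_zero]
  rw [integral_congr_ae ((ae_mem_unitBall n G).mono fun z hz => hinner z hz)] at hswap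
  rw [inner_eq_integral]
  simpa [Real.pi_ne_zero, Real.pi_pos.le] using hswap

end BergmanSpace

/-! ### Functions analytic at the origin, filtered by order of vanishing -/

/-- The functions on `ℂⁿ` which are analytic at `0`. -/
def germs (n : ℕ) : Submodule ℂ (Cn n → ℂ) where
  carrier := {f | AnalyticAt ℂ f 0}
  zero_mem' := analyticAt_const
  add_mem' := fun hf hg => AnalyticAt.add hf hg
  smul_mem' := fun c _ hf => (analyticAt_const (v := c)).smul hf

/-- The functions analytic at `0` which vanish there to order at least `k`. -/
def vanishing (n k : ℕ) : Submodule ℂ (germs n) where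
  carrier := {f | f.1 =O[𝓝 0] (fun z => ‖z‖ ^ k)}
  zero_mem' := isBigO_zero _ _
  add_mem' := fun hf hg => IsBigO.add hf hg
  smul_mem' := fun c _ hf => IsBigO.const_smul_left hf c

theorem mem_vanishing {n k : ℕ} {f : germs n} :
    f ∈ vanishing n k ↔ f.1 =O[𝓝 0] (fun z => ‖z‖ ^ k) := Iff.rfl

theorem isBigO_norm_pow_norm_pow {E : Type*} [NormedAddCommGroup E] {j k : ℕ} (h : j ≤ k) :
    (fun z : E => ‖z‖ ^ k) =O[𝓝 0] (fun z => ‖z‖ ^ j) := by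
  refine IsBigO.of_bound 1 ?_
  filter_upwards [ball_mem_nhds (0 : E) one_pos] with z hz
  have hz1 : ‖z‖ ≤ 1 := (mem_ball_zero_iff.1 hz).le
  simpa using pow_le_pow_of_le_one (norm_nonneg z) hz1 h

theorem vanishing_antitone {n j k : ℕ} (h : j ≤ k) : vanishing n k ≤ vanishing n j :=
  fun _ hf => IsBigO.trans hf (isBigO_norm_pow_norm_pow h)

/-- Composition with a map fixing `0`, on the functions analytic at `0`. -/
def germComp {n : ℕ} {φ : Cn n → Cn n} (hφ : AnalyticAt ℂ φ 0) (h0 : φ 0 = 0) :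
    germs n →ₗ[ℂ] germs n where
  toFun f := ⟨f.1 ∘ φ, AnalyticAt.comp (by rw [h0]; exact f.2) hφ⟩
  map_add' _ _ := rfl
  map_smul' _ _ := rfl

theorem isBigO_norm_of_map_zero {E F : Type*} [NormedAddCommGroup E] [NormedSpace ℂ E]
    [NormedAddCommGroup F] [NormedSpace ℂ F] {φ : E → F} (hφ : AnalyticAt ℂ φ 0)
    (h0 : φ 0 = 0) : φ =O[𝓝 0] (fun z => ‖z‖) := by
  simpa [h0] using (hφ.differentiableAt.isBigO_sub).norm_right

theorem germComp_mem_vanishing {n k : ℕ} {φ : Cn n → Cn n} (hφ : AnalyticAt ℂ φ 0)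
    (h0 : φ 0 = 0) {f : germs n} (hf : f ∈ vanishing n k) :
    germComp hφ h0 f ∈ vanishing n k := by
  have ht : Tendsto φ (𝓝 0) (𝓝 0) := by simpa [h0] using hφ.continuousAt.tendsto
  exact (IsBigO.comp_tendsto hf ht).trans (((isBigO_norm_of_map_zero hφ h0).norm_left).pow k)

/-! ### Taylor polynomials, and the orthogonal complement as an order condition -/

namespace BergmanSpace

variable {n : ℕ} {G : RadialWeight}

/-- The inclusion of `A²_G(𝔹ⁿ)` in the functions analytic at `0`. -/
def toGerm (n : ℕ) (G : RadialWeight) : BergmanSpace n G →ₗ[ℂ] germs n where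
  toFun f := ⟨f.1, f.2.1 0 (mem_ball_self one_pos)⟩
  map_add' _ _ := rfl
  map_smul' _ _ := rfl

/-- The restriction of an entire function to the ball, as an element of `A²_G(𝔹ⁿ)`. -/
def ofEntire (G : RadialWeight) (p : Cn n → ℂ) (hp : AnalyticOnNhd ℂ p Set.univ) :
    BergmanSpace n G := by
  refine ⟨(unitBall n).indicator p, ?_, fun z hz => Set.indicator_of_notMem hz _, ?_⟩
  · exact (hp.mono (Set.subset_univ _)).congr isOpen_ball
      (fun z hz => (Set.indicator_of_mem hz p).symm)
  · have hc : Continuous p := continuousOn_univ.1 hp.continuousOn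
    obtain ⟨M, hM⟩ := (isCompact_closedBall (0 : Cn n) 1).exists_bound_of_continuousOn
      hc.continuousOn
    refine MemLp.of_bound (hc.measurable.indicator measurableSet_ball).aestronglyMeasurable M ?_
    filter_upwards [ae_mem_unitBall n G] with z hz
    rw [Set.indicator_of_mem hz]
    exact hM z (ball_subset_closedBall hz)

theorem ofEntire_apply (p : Cn n → ℂ) (hp : AnalyticOnNhd ℂ p Set.univ) {z : Cn n}
    (hz : z ∈ unitBall n) : ofEntire G p hp z = p z :=
  Set.indicator_of_mem hz p

theorem analyticOnNhd_coord (i : Fin n) : AnalyticOnNhd ℂ (fun z : Cn n => z i) Set.univ :=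
  fun z _ => (EuclideanSpace.proj i : Cn n →L[ℂ] ℂ).analyticAt z

theorem analyticOnNhd_monomial (α : Fin n → ℕ) :
    AnalyticOnNhd ℂ (fun z : Cn n => ∏ i, z i ^ α i) Set.univ :=
  Finset.analyticOnNhd_fun_prod _ fun i _ => (analyticOnNhd_coord i).pow (α i)

/-- A function agreeing on the ball with a monomial of degree at most `K` is in the span. -/
theorem exists_mem_monomialSpan_monomial {K : ℕ} (α : Fin n → ℕ) (hα : ∑ i, α i ≤ K) :
    ∃ x ∈ monomialSpan n G K, ∀ z ∈ unitBall n, x z = ∏ i, z i ^ α i :=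
  ⟨ofEntire G _ (analyticOnNhd_monomial α),
    Submodule.subset_span ⟨α, hα, fun _ hz => ofEntire_apply _ _ hz⟩,
    fun _ hz => ofEntire_apply _ _ hz⟩

theorem exists_mem_monomialSpan_sum {K : ℕ} {ι : Type*} (s : Finset ι) (c : ι → ℂ)
    (q : ι → Cn n → ℂ)
    (h : ∀ i ∈ s, ∃ x ∈ monomialSpan n G K, ∀ z ∈ unitBall n, x z = q i z) :
    ∃ x ∈ monomialSpan n G K, ∀ z ∈ unitBall n, x z = ∑ i ∈ s, c i * q i z := by
  classical
  induction s using Finset.induction_on with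
  | empty => exact ⟨0, Submodule.zero_mem _, fun z _ => rfl⟩
  | insert a s ha ih =>
    obtain ⟨x, hx, hxz⟩ := ih fun i hi => h i (Finset.mem_insert_of_mem hi)
    obtain ⟨y, hy, hyz⟩ := h a (Finset.mem_insert_self _ _)
    refine ⟨c a • y + x, Submodule.add_mem _ (Submodule.smul_mem _ _ hy) hx, fun z hz => ?_⟩
    rw [Finset.sum_insert ha, ← hyz z hz, ← hxz z hz]
    rfl

theorem multilinear_diag_eq_sum {k : ℕ}
    (p : ContinuousMultilinearMap ℂ (fun _ : Fin k => Cn n) ℂ) (z : Cn n) :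
    (p fun _ => z) = ∑ r : Fin k → Fin n,
      (p fun i => EuclideanSpace.single (r i) 1) * ∏ i, z (r i) := by
  have hz : (p fun _ => z) = p fun _ => ∑ j, z j • EuclideanSpace.single j (1 : ℂ) := by
    congr 1
    funext _
    have := (EuclideanSpace.basisFun (Fin n) ℂ).sum_repr z
    simp only [EuclideanSpace.basisFun_repr, EuclideanSpace.basisFun_apply] at this
    exact this.symm
  rw [hz, p.map_sum]
  refine Finset.sum_congr rfl fun r _ => ?_
  rw [p.map_smul_univ, smul_eq_mul, mul_comm]

/-- Collect equal factors: the exponent of `z j` is the size of the fibre of `r` over `j`. -/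
theorem exists_mem_monomialSpan_prod {K k : ℕ} (hk : k ≤ K) (r : Fin k → Fin n) :
    ∃ x ∈ monomialSpan n G K, ∀ z ∈ unitBall n, x z = ∏ i, z (r i) := by
  obtain ⟨x, hx, hxz⟩ := exists_mem_monomialSpan_monomial (n := n) (G := G) (K := K)
    (fun j => (Finset.univ.filter fun i => r i = j).card) (by
      rw [← Finset.card_eq_sum_card_fiberwise (fun _ _ => Finset.mem_coe.2 (Finset.mem_univ _))]
      simpa using hk)
  refine ⟨x, hx, fun z hz => ?_⟩
  rw [hxz z hz, ← Finset.prod_fiberwise' Finset.univ r (fun j => z j)]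
  simp only [Finset.prod_const]

theorem exists_mem_monomialSpan_multilinear {K k : ℕ} (hk : k ≤ K)
    (p : ContinuousMultilinearMap ℂ (fun _ : Fin k => Cn n) ℂ) :
    ∃ x ∈ monomialSpan n G K, ∀ z ∈ unitBall n, x z = p fun _ => z := by
  obtain ⟨x, hx, hxz⟩ := exists_mem_monomialSpan_sum (n := n) (G := G) (K := K) Finset.univ
    (fun r : Fin k → Fin n => p fun i => EuclideanSpace.single (r i) 1)
    (fun r z => ∏ i, z (r i)) (fun r _ => exists_mem_monomialSpan_prod hk r)
  exact ⟨x, hx, fun z hz => (hxz z hz).trans (multilinear_diag_eq_sum p z).symm⟩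

/-- The Taylor polynomial of degree `K`. -/
theorem exists_taylor (G : RadialWeight) (K : ℕ) (f : germs n) :
    ∃ x ∈ monomialSpan n G K, f - toGerm n G x ∈ vanishing n (K + 1) := by
  obtain ⟨p, hp⟩ := f.2
  obtain ⟨x, hx, hxz⟩ := exists_mem_monomialSpan_sum (n := n) (G := G) (K := K)
    (Finset.range (K + 1)) (fun _ => 1) (fun k z => p k fun _ => z) fun k hk =>
      exists_mem_monomialSpan_multilinear (Nat.lt_succ_iff.1 (Finset.mem_range.1 hk)) (p k)
  refine ⟨x, hx, (hp.isBigO_sub_partialSum_pow (K + 1)).congr' ?_ EventuallyEq.rfl⟩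
  filter_upwards [ball_mem_nhds (0 : Cn n) one_pos] with z hz
  change _ = f.1 z - x z
  rw [hxz z hz, zero_add]
  simp [FormalMultilinearSeries.partialSum]

theorem inner_monomialSpan_eq_zero {K : ℕ} {x h : BergmanSpace n G} (hx : x ∈ monomialSpan n G K)
    (hh : toGerm n G h ∈ vanishing n (K + 1)) : inner ℂ x h = 0 := by
  induction hx using Submodule.span_induction with
  | mem x hx =>
    obtain ⟨α, hα, hxz⟩ := hx
    refine inner_eq_zero_of_homogeneous x h (∑ i, α i) (fun z hz c hc => ?_)
      (IsBigO.trans hh (isBigO_norm_pow_norm_pow (by omega)))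
    have hcz : c • z ∈ unitBall n := by
      rw [mem_ball_zero_iff, norm_smul, hc, one_mul]
      exact mem_ball_zero_iff.1 hz
    rw [hxz z hz, hxz _ hcz]
    simp [mul_pow, Finset.prod_mul_distrib, Finset.prod_pow_eq_pow_sum]
  | zero => exact inner_zero_left _
  | add x y _ _ hx hy => rw [inner_add_left, hx, hy, add_zero]
  | smul c x _ hx => rw [inner_smul_left, hx, mul_zero]

/-- Subtracting the Taylor polynomial from `h ∈ H₁ᗮ` leaves a remainder in `H₁ᗮ`. The polynomial
then lies in both `H₁` and `H₁ᗮ`, so it is zero. -/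
theorem mem_orthogonal_iff {K : ℕ} {h : BergmanSpace n G} :
    h ∈ (monomialSpan n G K)ᗮ ↔ toGerm n G h ∈ vanishing n (K + 1) := by
  refine ⟨fun hh => ?_, fun hh => fun x hx => inner_monomialSpan_eq_zero hx hh⟩
  obtain ⟨x, hx, hr⟩ := exists_taylor G K (toGerm n G h)
  rw [← map_sub] at hr
  have h1 : h - x ∈ (monomialSpan n G K)ᗮ := fun y hy => inner_monomialSpan_eq_zero hy hr
  have h2 : x ∈ (monomialSpan n G K)ᗮ := by simpa using Submodule.sub_mem _ hh h1
  have h3 : x = 0 := inner_self_eq_zero.1 (h2 x hx)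
  simpa [h3] using hr

/-- The polynomials of degree at most `K` are the `K`-jets of functions analytic at `0`. -/
def jetEquiv (n : ℕ) (G : RadialWeight) (K : ℕ) :
    monomialSpan n G K ≃ₗ[ℂ] germs n ⧸ vanishing n (K + 1) :=
  LinearEquiv.ofBijective
    ((vanishing n (K + 1)).mkQ ∘ₗ toGerm n G ∘ₗ (monomialSpan n G K).subtype) (by
    constructor
    · rw [← LinearMap.ker_eq_bot, LinearMap.ker_eq_bot']
      intro x hx
      have h1 : toGerm n G x.1 ∈ vanishing n (K + 1) := (Submodule.Quotient.mk_eq_zero _).1 hx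
      exact Subtype.ext (inner_self_eq_zero.1 (inner_monomialSpan_eq_zero x.2 h1))
    · intro q
      obtain ⟨f, rfl⟩ := Submodule.mkQ_surjective _ q
      obtain ⟨x, hx, hr⟩ := exists_taylor G K f
      exact ⟨⟨x, hx⟩, ((Submodule.Quotient.eq _).2 hr).symm⟩)

theorem finiteDimensional_jets (n : ℕ) (G : RadialWeight) (k : ℕ) :
    FiniteDimensional ℂ (germs n ⧸ vanishing n (k + 1)) :=
  (jetEquiv n G k).finiteDimensional

/-- The Taylor polynomial of degree `K` at `0`. -/
def jet (n : ℕ) (G : RadialWeight) (K : ℕ) : germs n →ₗ[ℂ] monomialSpan n G K :=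
  (jetEquiv n G K).symm.toLinearMap ∘ₗ (vanishing n (K + 1)).mkQ

theorem sub_jet_mem {K : ℕ} (f : germs n) :
    f - toGerm n G (jet n G K f) ∈ vanishing n (K + 1) := by
  rw [← Submodule.Quotient.eq]
  exact ((jetEquiv n G K).apply_symm_apply _).symm

theorem jet_eq_zero_iff {K : ℕ} {f : germs n} : jet n G K f = 0 ↔ f ∈ vanishing n (K + 1) := by
  simp [jet]

theorem jet_toGerm {K : ℕ} (x : monomialSpan n G K) : jet n G K (toGerm n G x) = x :=
  (jetEquiv n G K).symm_apply_apply x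

theorem toGerm_jet_mem_vanishing_iff {K k : ℕ} (hk : k ≤ K + 1) {f : germs n} :
    toGerm n G (jet n G K f) ∈ vanishing n k ↔ f ∈ vanishing n k := by
  have := vanishing_antitone hk (sub_jet_mem (G := G) (K := K) f)
  constructor
  · intro h
    simpa using Submodule.add_mem _ this h
  · intro h
    simpa using Submodule.sub_mem _ h this

/-! ### The blocks in terms of orders and jets -/

section Blocks

variable {φ : Cn n → Cn n}

/-- The two functions agree on the ball and may differ outside it, because `C_φ f` is extended by
zero; hence membership for every `k` instead of equality. -/
theorem toGerm_composition_sub_mem (hφ : AnalyticAt ℂ φ 0) (h0 : φ 0 = 0)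
    (hG : IsCompactComposition n G φ) (k : ℕ) (f : BergmanSpace n G) :
    toGerm n G (compositionCLM hG f) - germComp hφ h0 (toGerm n G f) ∈ vanishing n k := by
  refine (isBigO_zero (fun z : Cn n => ‖z‖ ^ k) (𝓝 0)).congr' (f₁ := fun _ => (0 : ℂ)) ?_
    EventuallyEq.rfl
  filter_upwards [ball_mem_nhds (0 : Cn n) one_pos] with z hz
  change 0 = (unitBall n).indicator (f.1 ∘ φ) z - f.1 (φ z)
  rw [Set.indicator_of_mem hz]
  simp

theorem toGerm_composition_mem_vanishing (hφ : AnalyticAt ℂ φ 0) (h0 : φ 0 = 0)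
    (hG : IsCompactComposition n G φ) {k : ℕ} {f : BergmanSpace n G}
    (hf : toGerm n G f ∈ vanishing n k) :
    toGerm n G (compositionCLM hG f) ∈ vanishing n k := by
  simpa using Submodule.add_mem _ (toGerm_composition_sub_mem hφ h0 hG k f)
    (germComp_mem_vanishing hφ h0 hf)

/-- Truncating `f` and projecting to `H₁` both discard only terms of order greater than `K`, and
composition with `φ` keeps such terms in that range. -/
theorem blockU_jet (hφ : AnalyticAt ℂ φ 0) (h0 : φ 0 = 0)
    (hG : IsCompactComposition n G φ) (K : ℕ) (f : germs n) :
    blockU hG K (jet n G K f) = jet n G K (germComp hφ h0 f) := by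
  set x := jet n G K f with hx
  set y := compositionCLM hG x.1 with hy
  have h1 : y - (blockU hG K x).1 ∈ (monomialSpan n G K)ᗮ :=
    Submodule.sub_starProjection_mem_orthogonal (K := monomialSpan n G K) y
  have h2 := mem_orthogonal_iff.1 h1
  have h3 := toGerm_composition_sub_mem hφ h0 hG (K + 1) x.1
  have h4 : germComp hφ h0 (f - toGerm n G x) ∈ vanishing n (K + 1) :=
    germComp_mem_vanishing hφ h0 (sub_jet_mem f)
  have h5 : germComp hφ h0 f - toGerm n G (blockU hG K x).1 ∈ vanishing n (K + 1) := by
    have := Submodule.sub_mem _ (Submodule.add_mem _ h2 h4) h3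
    rw [map_sub, map_sub] at this
    convert this using 1
    rw [hy]
    abel
  have h6 := jet_eq_zero_iff (G := G).2 h5
  rw [map_sub, jet_toGerm, sub_eq_zero] at h6
  exact h6.symm

/-- `H₂` is invariant under `C_φ`, so the projection does nothing. -/
theorem coe_blockW (hφ : AnalyticAt ℂ φ 0) (h0 : φ 0 = 0)
    (hG : IsCompactComposition n G φ) (K : ℕ) (x : (monomialSpan n G K)ᗮ) :
    (blockW hG K x : BergmanSpace n G) = compositionCLM hG x.1 := by
  have h1 : compositionCLM hG x.1 ∈ (monomialSpan n G K)ᗮ :=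
    mem_orthogonal_iff.2 (toGerm_composition_mem_vanishing hφ h0 hG (mem_orthogonal_iff.1 x.2))
  exact Submodule.starProjection_eq_self_iff.2 h1

end Blocks

end BergmanSpace

/-! ### Linear algebra of an operator preserving a subspace -/

/-- If `T` is injective on `Z`, it is onto `Z` and `p` can be corrected by an element of `Z`;
otherwise `Z` itself contains a kernel vector. -/
theorem exists_mem_ker_of_triangular {X : Type*} [AddCommGroup X] [Module ℂ X]
    [FiniteDimensional ℂ X] (T : X →ₗ[ℂ] X) {Y Z : Submodule ℂ X} (hZY : Z ≤ Y)
    (hTZ : ∀ x ∈ Z, T x ∈ Z) {p : X} (hpY : p ∈ Y) (hpZ : p ∉ Z) (hTp : T p ∈ Z) :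
    ∃ w ∈ Y, w ≠ 0 ∧ T w = 0 := by
  by_cases hinj : Function.Injective (T.restrict hTZ)
  · obtain ⟨q, hq⟩ := LinearMap.injective_iff_surjective.1 hinj ⟨T p, hTp⟩
    have hq' : T q.1 = T p := congrArg Subtype.val hq
    refine ⟨p - q.1, Submodule.sub_mem _ hpY (hZY q.2), fun h => hpZ ?_, by
      rw [map_sub, hq', sub_self]⟩
    rw [sub_eq_zero.1 h]
    exact q.2
  · rw [← LinearMap.ker_eq_bot, Submodule.eq_bot_iff] at hinj
    push Not at hinj
    obtain ⟨w, hw, hw0⟩ := hinj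
    exact ⟨w.1, hZY w.2, fun h => hw0 (Subtype.ext h), congrArg Subtype.val hw⟩

/-- The induced map on the finite-dimensional `X ⧸ Z` is surjective, hence injective. -/
theorem mem_of_map_mem_of_surjective {X : Type*} [AddCommGroup X] [Module ℂ X]
    (T : X →ₗ[ℂ] X) (hT : Function.Surjective T) {Z : Submodule ℂ X}
    [FiniteDimensional ℂ (X ⧸ Z)] (hTZ : ∀ x ∈ Z, T x ∈ Z) {p : X} (hTp : T p ∈ Z) : p ∈ Z := by
  have hs : Function.Surjective (Z.mapQ Z T hTZ) := by
    intro q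
    obtain ⟨y, rfl⟩ := Submodule.mkQ_surjective _ q
    obtain ⟨x, rfl⟩ := hT y
    exact ⟨Z.mkQ x, rfl⟩
  have hi := LinearMap.injective_iff_surjective.2 hs
  rw [← Submodule.Quotient.mk_eq_zero]
  refine hi ?_
  rw [map_zero]
  exact (Submodule.Quotient.mk_eq_zero _).2 hTp

/-! ### Resonant products of eigenfunctionals -/

/-- The linear functional `z ↦ ∑ i, x i * z i`. -/
def coordFunctional {n : ℕ} (x : Fin n → ℂ) : Cn n →L[ℂ] ℂ :=
  ∑ i, x i • (EuclideanSpace.proj i : Cn n →L[ℂ] ℂ)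

theorem coordFunctional_apply {n : ℕ} (x : Fin n → ℂ) (z : Cn n) :
    coordFunctional x z = ∑ i, x i * z i := by
  simp [coordFunctional]

theorem coordFunctional_fderiv {n : ℕ} (φ : Cn n → Cn n) (x : Fin n → ℂ) :
    coordFunctional x ∘L fderiv ℂ φ 0 =
      coordFunctional ((jacobianZero φ).transpose.mulVec x) := by
  refine ContinuousLinearMap.coe_injective
    ((EuclideanSpace.basisFun (Fin n) ℂ).toBasis.ext fun j => ?_)
  simp only [OrthonormalBasis.coe_toBasis, EuclideanSpace.basisFun_apply,
    ContinuousLinearMap.coe_coe, ContinuousLinearMap.comp_apply, coordFunctional_apply,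
    Matrix.mulVec, dotProduct, Matrix.transpose_apply, jacobianZero, Matrix.of_apply]
  simp [mul_comm]

/-- A matrix and its transpose have the same characteristic polynomial. -/
theorem exists_left_eigenvector {n : ℕ} {A : Matrix (Fin n) (Fin n) ℂ} {ν : ℂ}
    (h : Module.End.HasEigenvalue (Matrix.toLin' A) ν) :
    ∃ x : Fin n → ℂ, x ≠ 0 ∧ A.transpose.mulVec x = ν • x := by
  rw [Module.End.hasEigenvalue_iff_isRoot_charpoly, Matrix.charpoly_toLin',
    ← Matrix.charpoly_transpose, ← Matrix.charpoly_toLin',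
    ← Module.End.hasEigenvalue_iff_isRoot_charpoly] at h
  obtain ⟨x, hx⟩ := h.exists_hasEigenvector
  exact ⟨x, hx.2, by simpa using hx.apply_eq_smul⟩

theorem isBigO_sq_of_hasFDerivAt_zero {n : ℕ} {f : Cn n → ℂ} (hf : AnalyticAt ℂ f 0)
    (h0 : f 0 = 0) (hd : HasFDerivAt f (0 : Cn n →L[ℂ] ℂ) 0) :
    f =O[𝓝 0] (fun z => ‖z‖ ^ 2) := by
  obtain ⟨p, hp⟩ := hf
  refine (hp.isBigO_sub_partialSum_pow 2).congr' (Eventually.of_forall fun z => ?_)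
    EventuallyEq.rfl
  have h1 : (p 1 fun _ => z) = 0 := by
    have h2 := hp.hasFDerivAt.unique hd
    have h3 := congrArg (fun T : Cn n →L[ℂ] ℂ => T z) h2
    simpa [Matrix.vec_single_eq_const] using h3
  have h2 : (p 0 fun _ => z) = 0 := by rw [hp.coeff_zero, h0]
  simp [FormalMultilinearSeries.partialSum, Finset.sum_range_succ, h1, h2]

theorem coordFunctional_comp_sub_isBigO {n : ℕ} {φ : Cn n → Cn n} (hφ : AnalyticAt ℂ φ 0)
    (h0 : φ 0 = 0) {x : Fin n → ℂ} {ν : ℂ}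
    (hx : (jacobianZero φ).transpose.mulVec x = ν • x) :
    (fun z => coordFunctional x (φ z) - ν * coordFunctional x z) =O[𝓝 0] (fun z => ‖z‖ ^ 2) := by
  have hd : HasFDerivAt φ (fderiv ℂ φ 0) 0 := hφ.differentiableAt.hasFDerivAt
  have ha : AnalyticAt ℂ (fun z => coordFunctional x (φ z)) 0 :=
    ((coordFunctional x).analyticAt _).comp hφ
  have hb : AnalyticAt ℂ (fun z => ν * coordFunctional x z) 0 :=
    analyticAt_const.mul ((coordFunctional x).analyticAt _)
  refine isBigO_sq_of_hasFDerivAt_zero (ha.sub hb) (by simp [h0]) ?_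
  have h1 : HasFDerivAt (fun z => coordFunctional x (φ z))
      (coordFunctional x ∘L fderiv ℂ φ 0) 0 :=
    (coordFunctional x).hasFDerivAt.comp 0 hd
  have h2 : HasFDerivAt (fun z => ν * coordFunctional x z) (ν • coordFunctional x) 0 :=
    (coordFunctional x).hasFDerivAt.const_mul ν
  have h3 : coordFunctional x ∘L fderiv ℂ φ 0 - ν • coordFunctional x = 0 := by
    rw [coordFunctional_fderiv, hx]
    ext z
    simp [coordFunctional_apply, Finset.mul_sum, mul_assoc]
  rw [← h3]
  exact h1.sub h2

theorem prod_coordFunctional_isBigO {n : ℕ} {ι : Type*} (s : Finset ι) (x : ι → Fin n → ℂ) :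
    (fun z : Cn n => ∏ i ∈ s, coordFunctional (x i) z) =O[𝓝 0] (fun z => ‖z‖ ^ s.card) := by
  classical
  induction s using Finset.induction_on with
  | empty => simpa using isBigO_refl (fun _ : Cn n => (1 : ℝ)) (𝓝 0)
  | insert a s ha ih =>
    simp only [Finset.prod_insert ha, Finset.card_insert_of_notMem ha, pow_succ']
    exact (isBigO_norm_of_map_zero ((coordFunctional (x a)).analyticAt 0) (map_zero _)).mul ih

theorem prod_coordFunctional_comp_sub_isBigO {n : ℕ} {φ : Cn n → Cn n} (hφ : AnalyticAt ℂ φ 0)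
    (h0 : φ 0 = 0) {ι : Type*} (s : Finset ι) (x : ι → Fin n → ℂ) (ν : ι → ℂ)
    (hx : ∀ i, (jacobianZero φ).transpose.mulVec (x i) = ν i • x i) :
    (fun z => ∏ i ∈ s, coordFunctional (x i) (φ z) -
      (∏ i ∈ s, ν i) * ∏ i ∈ s, coordFunctional (x i) z)
      =O[𝓝 0] (fun z => ‖z‖ ^ (s.card + 1)) := by
  classical
  induction s using Finset.induction_on with
  | empty => simpa using isBigO_zero (fun z : Cn n => ‖z‖) (𝓝 0)
  | insert a s ha ih =>
    have h1 : (fun z => coordFunctional (x a) (φ z)) =O[𝓝 0] (fun z => ‖z‖) :=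
      isBigO_norm_of_map_zero (((coordFunctional (x a)).analyticAt _).comp hφ) (by simp [h0])
    have h2 := (h1.mul ih).congr_right (g₂ := fun z => ‖z‖ ^ (s.card + 1 + 1))
      (fun z => by ring)
    have h3 := ((coordFunctional_comp_sub_isBigO hφ h0 (hx a)).mul
      ((prod_coordFunctional_isBigO s x).const_mul_left (∏ i ∈ s, ν i))).congr_right
      (g₂ := fun z => ‖z‖ ^ (s.card + 1 + 1)) (fun z => by ring)
    rw [Finset.card_insert_of_notMem ha]
    -- Telescoping: `(u∘φ)(v∘φ) - νλ uv = (u∘φ)(v∘φ - λ v) + (u∘φ - ν u) λ v`.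
    refine (h2.add h3).congr_left fun z => ?_
    simp only [Finset.prod_insert ha]
    ring

/-- Finitely many nonzero functionals are all nonzero at some `z`; along the line through `z` the
product is a nonzero multiple of `c ^ card ι`. -/
theorem prod_coordFunctional_not_isBigO {n : ℕ} {ι : Type*} [Fintype ι] (x : ι → Fin n → ℂ)
    (hx : ∀ i, x i ≠ 0) :
    ¬ (fun z : Cn n => ∏ i, coordFunctional (x i) z)
      =O[𝓝 0] (fun z => ‖z‖ ^ (Fintype.card ι + 1)) := by
  intro hO
  obtain ⟨z, -, hz⟩ := Module.Dual.exists_forall_mem_ne_zero_of_forall_exists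
    (⊤ : Submodule ℂ (Cn n)) (fun i => (coordFunctional (x i)).toLinearMap) (fun i => by
      obtain ⟨j, hj⟩ := Function.ne_iff.1 (hx i)
      refine ⟨EuclideanSpace.single j 1, Submodule.mem_top, ?_⟩
      simpa [coordFunctional_apply] using hj)
  set P : ℂ := ∏ i, coordFunctional (x i) z with hP
  have hP0 : P ≠ 0 := Finset.prod_ne_zero_iff.2 fun i _ => hz i
  have ht : Tendsto (fun c : ℂ => c • z) (𝓝[≠] 0) (𝓝 0) := by
    have : Tendsto (fun c : ℂ => c • z) (𝓝 0) (𝓝 ((0 : ℂ) • z)) :=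
      (continuous_id.smul continuous_const).tendsto 0
    simpa using this.mono_left nhdsWithin_le_nhds
  have h1 : (fun c : ℂ => c ^ Fintype.card ι) =O[𝓝[≠] 0]
      (fun c : ℂ => c ^ (Fintype.card ι + 1)) := by
    have h2 := (hO.comp_tendsto ht).const_mul_left P⁻¹
    refine (h2.congr_left (f₂ := fun c : ℂ => c ^ Fintype.card ι) fun c => ?_).trans
      (IsBigO.of_bound (‖z‖ ^ (Fintype.card ι + 1)) (Eventually.of_forall fun c => ?_))
    · simp only [Function.comp_apply, map_smul, smul_eq_mul, Finset.prod_mul_distrib,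
        Finset.prod_const, Finset.card_univ]
      rw [← hP]
      field_simp
    · simp [norm_smul, mul_pow, mul_comm]
  have h2 : (fun c : ℂ => c ^ (Fintype.card ι + 1)) =o[𝓝[≠] 0]
      (fun c : ℂ => c ^ Fintype.card ι) :=
    (isLittleO_pow_pow (Nat.lt_succ_self _)).mono nhdsWithin_le_nhds
  refine isLittleO_irrefl ?_ (h1.trans_isLittleO h2)
  refine Eventually.frequently ?_
  filter_upwards [self_mem_nhdsWithin] with c hc
  exact pow_ne_zero _ hc

/-- A resonance yields a homogeneous polynomial which is an eigenvector of composition with `φ`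
modulo terms of higher order. -/
theorem IsResonantEigenvalue.exists_homogeneous {n : ℕ} {φ : Cn n → Cn n}
    (hφ : AnalyticAt ℂ φ 0) (h0 : φ 0 = 0) {μ : ℂ}
    (hμ : IsResonantEigenvalue (jacobianZero φ) μ) :
    ∃ k, 2 ≤ k ∧ ∃ p : Cn n → ℂ, AnalyticOnNhd ℂ p Set.univ ∧
      p =O[𝓝 0] (fun z => ‖z‖ ^ k) ∧ ¬ p =O[𝓝 0] (fun z => ‖z‖ ^ (k + 1)) ∧
      (fun z => p (φ z) - μ * p z) =O[𝓝 0] (fun z => ‖z‖ ^ (k + 1)) := by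
  obtain ⟨-, s, hs2, hs, hprod⟩ := hμ
  -- Indexing by list positions allows repeated eigenvalues.
  obtain ⟨l, rfl⟩ := Quot.exists_rep s
  choose x hx0 hx using fun i : Fin l.length =>
    exists_left_eigenvector (hs l[i] (Multiset.mem_coe.2 (List.getElem_mem i.2)))
  refine ⟨l.length, hs2, fun z => ∏ i, coordFunctional (x i) z, ?_, ?_, ?_, ?_⟩
  · exact Finset.analyticOnNhd_fun_prod _ fun i _ z _ => (coordFunctional (x i)).analyticAt z
  · simpa using prod_coordFunctional_isBigO Finset.univ x
  · simpa using prod_coordFunctional_not_isBigO x hx0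
  · have hμl : ∏ i : Fin l.length, l[i] = μ := by
      rw [← hprod]
      simp
    have := prod_coordFunctional_comp_sub_isBigO hφ h0 Finset.univ x (fun i => l[i]) hx
    rw [hμl] at this
    simpa using this

/-! ### The additional eigenvector of `U` -/

namespace BergmanSpace

variable {n : ℕ} {G : RadialWeight} {φ : Cn n → Cn n}

/-- The order of vanishing at `0` of an approximate eigenvector is at most `K` when its eigenvalue
is not in the spectrum of the block on `⟨z^α : |α| ≤ K⟩ᗮ`. -/
theorem order_le_of_notMem_spectrum (hφ : AnalyticAt ℂ φ 0) (h0 : φ 0 = 0)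
    (hG : IsCompactComposition n G φ) {μ : ℂ} {K : ℕ} (hK : μ ∉ spectrum ℂ (blockW hG K))
    {k : ℕ} {p : Cn n → ℂ} (hp : AnalyticOnNhd ℂ p Set.univ)
    (hpk : p =O[𝓝 0] (fun z => ‖z‖ ^ k)) (hpk' : ¬ p =O[𝓝 0] (fun z => ‖z‖ ^ (k + 1)))
    (hpφ : (fun z => p (φ z) - μ * p z) =O[𝓝 0] (fun z => ‖z‖ ^ (k + 1))) : k ≤ K := by
  by_contra! hkK
  set q : BergmanSpace n G := ofEntire G p hp with hq
  have hqp : (q : Cn n → ℂ) =ᶠ[𝓝 0] p := by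
    filter_upwards [ball_mem_nhds (0 : Cn n) one_pos] with z hz using ofEntire_apply p hp hz
  have hqk : toGerm n G q ∈ vanishing n (K + 1) :=
    vanishing_antitone hkK (mem_vanishing.2 (hpk.congr' hqp.symm EventuallyEq.rfl))
  set H := (monomialSpan n G K)ᗮ with hH
  -- Being the kernel of a map to the finite-dimensional space of `k`-jets, `Z` has finite
  -- codimension in `H`.
  let Z : Submodule ℂ H := LinearMap.ker ((vanishing n (k + 1)).mkQ ∘ₗ toGerm n G ∘ₗ H.subtype)
  have hZ : ∀ x : H, x ∈ Z ↔ toGerm n G x.1 ∈ vanishing n (k + 1) := fun x =>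
    Submodule.Quotient.mk_eq_zero _
  have := finiteDimensional_jets n G k
  have hfin : FiniteDimensional ℂ (H ⧸ Z) :=
    (LinearMap.quotKerEquivRange _).symm.finiteDimensional
  let T : H →L[ℂ] H := algebraMap ℂ (H →L[ℂ] H) μ - blockW hG K
  have hTapply : ∀ x : H, (T x).1 = μ • x.1 - compositionCLM hG x.1 := fun x => by
    rw [← coe_blockW hφ h0 hG K x]
    rfl
  have hsurj : Function.Surjective T.toLinearMap := by
    obtain ⟨u, hu⟩ := spectrum.notMem_iff.1 hK
    intro y
    refine ⟨(↑u⁻¹ : H →L[ℂ] H) y, ?_⟩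
    change T _ = y
    have h1 : (T * (↑u⁻¹ : H →L[ℂ] H)) y = y := by
      change ((algebraMap ℂ (H →L[ℂ] H) μ - blockW hG K) * (↑u⁻¹ : H →L[ℂ] H)) y = y
      rw [← hu, u.mul_inv]
      rfl
    exact h1
  have hTZ : ∀ x ∈ Z, T.toLinearMap x ∈ Z := fun x hx => by
    rw [hZ] at hx ⊢
    change toGerm n G (T x).1 ∈ _
    rw [hTapply, map_sub, map_smul]
    exact Submodule.sub_mem _ (Submodule.smul_mem _ _ hx)
      (toGerm_composition_mem_vanishing hφ h0 hG hx)
  have hmem : (⟨q, mem_orthogonal_iff.2 hqk⟩ : H) ∈ Z := by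
    refine mem_of_map_mem_of_surjective T.toLinearMap hsurj hTZ ?_
    rw [hZ]
    change toGerm n G (T _).1 ∈ _
    rw [hTapply, map_sub, map_smul]
    have h1 := toGerm_composition_sub_mem hφ h0 hG (k + 1) q
    have h2 : germComp hφ h0 (toGerm n G q) - μ • toGerm n G q ∈ vanishing n (k + 1) := by
      refine mem_vanishing.2 (hpφ.congr' ?_ EventuallyEq.rfl)
      have ht : Tendsto φ (𝓝 0) (𝓝 0) := by simpa [h0] using hφ.continuousAt.tendsto
      filter_upwards [hqp, ht.eventually hqp] with z hz1 hz2
      change _ = q (φ z) - μ * q z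
      rw [hz1, hz2]
    have h3 := Submodule.neg_mem _ (Submodule.add_mem _ h1 h2)
    convert h3 using 1
    abel
  exact hpk' ((mem_vanishing.1 ((hZ _).1 hmem)).congr' hqp EventuallyEq.rfl)

/-- An approximate eigenvector vanishing to order `k`, `2 ≤ k ≤ K`, yields an eigenvector of the
block on `⟨z^α : |α| ≤ K⟩` which vanishes to order at least `2`. -/
theorem exists_eigenvector_blockU (hφ : AnalyticAt ℂ φ 0) (h0 : φ 0 = 0)
    (hG : IsCompactComposition n G φ) {μ : ℂ} {K k : ℕ} (hk2 : 2 ≤ k) (hkK : k ≤ K)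
    {p : germs n} (hpk : p ∈ vanishing n k) (hpk' : p ∉ vanishing n (k + 1))
    (hpφ : germComp hφ h0 p - μ • p ∈ vanishing n (k + 1)) :
    ∃ w : monomialSpan n G K, w ≠ 0 ∧ blockU hG K w = μ • w ∧
      toGerm n G w.1 ∈ vanishing n 2 := by
  let M : ℕ → Submodule ℂ (monomialSpan n G K) := fun j =>
    (vanishing n j).comap (toGerm n G ∘ₗ (monomialSpan n G K).subtype)
  have hM : ∀ j x, x ∈ M j ↔ toGerm n G x.1 ∈ vanishing n j := fun _ _ => Iff.rfl
  let T : monomialSpan n G K →ₗ[ℂ] monomialSpan n G K :=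
    (blockU hG K).toLinearMap - μ • LinearMap.id
  have hT : ∀ f : germs n, T (jet n G K f) = jet n G K (germComp hφ h0 f - μ • f) := fun f => by
    rw [map_sub, map_smul, ← blockU_jet hφ h0 hG]
    rfl
  -- The choice `Y = M 2` records that the eigenvector has no linear part, which later separates it
  -- from the jets coming from `F`.
  obtain ⟨w, hwY, hw0, hw⟩ := exists_mem_ker_of_triangular T (Y := M 2) (Z := M (k + 1))
    (p := jet n G K p)
    (fun x hx => vanishing_antitone (by omega) hx) (fun x hx => by
      rw [← jet_toGerm x, hT, hM, toGerm_jet_mem_vanishing_iff (by omega)]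
      exact Submodule.sub_mem _ (germComp_mem_vanishing hφ h0 hx) (Submodule.smul_mem _ _ hx))
    (by rw [hM, toGerm_jet_mem_vanishing_iff (by omega)]; exact vanishing_antitone hk2 hpk)
    (by rwa [hM, toGerm_jet_mem_vanishing_iff (by omega)])
    (by rwa [hT, hM, toGerm_jet_mem_vanishing_iff (by omega)])
  exact ⟨w, hw0, sub_eq_zero.1 hw, hwY⟩

end BergmanSpace

/-! ### Eigenfunctions from a full rank solution -/

/-- The linear combinations of the components of a map analytic at `0`. -/
def componentCombination {n d : ℕ} {F : Cn n → Fin d → ℂ} (hF : AnalyticAt ℂ F 0) :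
    (Fin d → ℂ) →ₗ[ℂ] germs n where
  toFun a := ⟨fun z => ∑ i, a i * F z i,
    Finset.analyticAt_fun_sum _ fun i _ => analyticAt_const.mul
      (((ContinuousLinearMap.proj i : (Fin d → ℂ) →L[ℂ] ℂ).analyticAt _).comp hF)⟩
  map_add' a b := Subtype.ext (funext fun z => by
    change ∑ i, (a i + b i) * F z i = ∑ i, a i * F z i + ∑ i, b i * F z i
    simp only [add_mul, Finset.sum_add_distrib])
  map_smul' c a := Subtype.ext (funext fun z => by
    change ∑ i, (c * a i) * F z i = c * ∑ i, a i * F z i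
    simp only [mul_assoc, Finset.mul_sum])

/-- The derivative of `a·F` at `0` is `a·F'(0)`; evaluating it at preimages of the standard basis
vectors reads off the entries of `a`. -/
theorem eq_zero_of_componentCombination_mem_vanishing {n d : ℕ} {F : Cn n → Fin d → ℂ}
    (hF : AnalyticAt ℂ F 0) (hrank : Function.Surjective (fderiv ℂ F 0)) {a : Fin d → ℂ}
    (ha : componentCombination hF a ∈ vanishing n 2) : a = 0 := by
  have h1 : HasFDerivAt (componentCombination hF a).1 (0 : Cn n →L[ℂ] ℂ) 0 :=
    IsBigO.hasFDerivAt (n := 2) (by simpa using mem_vanishing.1 ha) (by norm_num)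
  have h2 : HasFDerivAt (fun z => ∑ i, a i * F z i)
      (∑ i, a i • ((ContinuousLinearMap.proj i : (Fin d → ℂ) →L[ℂ] ℂ) ∘L fderiv ℂ F 0)) 0 := by
    refine HasFDerivAt.fun_sum fun i _ => HasFDerivAt.const_mul ?_ (a i)
    exact (ContinuousLinearMap.proj i : (Fin d → ℂ) →L[ℂ] ℂ).hasFDerivAt.comp 0
      hF.differentiableAt.hasFDerivAt
  have h3 := h2.unique h1
  funext j
  obtain ⟨v, hv⟩ := hrank (Pi.single j 1)
  have h4 := congrArg (fun T : Cn n →L[ℂ] ℂ => T v) h3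
  simpa [hv, Pi.single_apply] using h4

/-- Moving `Lᵗ` across the dot product gives `a·(Lᵗ F) = (L a)·F`, so eigenvectors of `L` yield
eigenfunctions of composition. -/
theorem IsFullRankBlockSolution.germComp_componentCombination {n d : ℕ} {φ : Cn n → Cn n}
    (hφ : AnalyticAt ℂ φ 0) (h0 : φ 0 = 0) {L : Matrix (Fin d) (Fin d) ℂ} {F : Cn n → Fin d → ℂ}
    (hF : IsFullRankBlockSolution φ L F) (hF0 : AnalyticAt ℂ F 0) (a : Fin d → ℂ) (k : ℕ) :
    germComp hφ h0 (componentCombination hF0 a) - componentCombination hF0 (L.mulVec a) ∈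
      vanishing n k := by
  refine (isBigO_zero (fun z : Cn n => ‖z‖ ^ k) (𝓝 0)).congr' (f₁ := fun _ => (0 : ℂ)) ?_
    EventuallyEq.rfl
  filter_upwards [ball_mem_nhds (0 : Cn n) one_pos] with z hz
  change 0 = a ⬝ᵥ F (φ z) - L.mulVec a ⬝ᵥ F z
  rw [hF.equation z hz, Matrix.dotProduct_mulVec, Matrix.vecMul_transpose, sub_self]

/-- Coordinates, in a basis of the generalized eigenspace, of the eigenvectors. -/
def eigenvectorCoords {n d : ℕ} (A : Matrix (Fin n) (Fin n) ℂ) (μ : ℂ)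
    (b : Module.Basis (Fin d) ℂ (genEigenspace A μ)) :
    LinearMap.ker (Matrix.toLin' A - μ • LinearMap.id) →ₗ[ℂ] (Fin d → ℂ) :=
  b.equivFun.toLinearMap ∘ₗ Submodule.inclusion (fun x hx =>
    Module.End.mem_maxGenEigenspace _ _ _ |>.2 ⟨1, by
      rw [pow_one]
      exact hx⟩)

theorem eigenvectorCoords_injective {n d : ℕ} (A : Matrix (Fin n) (Fin n) ℂ) (μ : ℂ)
    (b : Module.Basis (Fin d) ℂ (genEigenspace A μ)) :
    Function.Injective (eigenvectorCoords A μ b) :=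
  b.equivFun.injective.comp (Submodule.inclusion_injective _)

theorem genEigenspaceMatrix_mulVec_eigenvectorCoords {n d : ℕ} (A : Matrix (Fin n) (Fin n) ℂ)
    (μ : ℂ) (b : Module.Basis (Fin d) ℂ (genEigenspace A μ))
    (x : LinearMap.ker (Matrix.toLin' A - μ • LinearMap.id)) :
    (genEigenspaceMatrix A μ b).mulVec (eigenvectorCoords A μ b x) =
      μ • eigenvectorCoords A μ b x := by
  rw [← map_smul]
  change (LinearMap.toMatrix b b _).mulVec (b.repr _) = b.repr _
  rw [LinearMap.toMatrix_mulVec_repr]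
  congr 2
  exact Subtype.ext (sub_eq_zero.1 x.2)

end

/-! ### The dimension count -/

open BergmanSpace

theorem mainTheorem7 (n : ℕ) (φ : Cn n → Cn n)
    (hφ_analytic : AnalyticOnNhd ℂ φ (unitBall n))
    (hφ_self : Set.MapsTo φ (unitBall n) (unitBall n))
    (hφ_zero : φ 0 = 0)
    (hφ_slice : ¬ UnitaryOnSlice φ)
    (hφ_rank : (jacobianZero φ).det ≠ 0)
    (G : RadialWeight) (hG : BergmanSpace.IsCompactComposition n G φ)
    (μ : ℂ) (hμ : IsResonantEigenvalue (jacobianZero φ) μ)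
    (K : ℕ) (hK : μ ∉ spectrum ℂ (blockW hG K))
    (hdim : Module.finrank ℂ
        (LinearMap.ker ((blockU hG K).toLinearMap - μ • LinearMap.id)) =
      Module.finrank ℂ
        (LinearMap.ker (Matrix.toLin' (jacobianZero φ).transpose - μ • LinearMap.id)))
    (d : ℕ) (b : Module.Basis (Fin d) ℂ (genEigenspace (jacobianZero φ).transpose μ)) :
    ¬ ∃ F : Cn n → Fin d → ℂ,
      IsFullRankBlockSolution φ (genEigenspaceMatrix (jacobianZero φ).transpose μ b) F := by
  rintro ⟨F, hF⟩
  have hφ : AnalyticAt ℂ φ 0 := hφ_analytic 0 (mem_ball_self one_pos)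
  have hF0 : AnalyticAt ℂ F 0 := hF.analytic 0 (mem_ball_self one_pos)
  obtain ⟨k, hk2, p, hp, hpk, hpk', hpφ⟩ := hμ.exists_homogeneous hφ hφ_zero
  have hkK : k ≤ K := order_le_of_notMem_spectrum hφ hφ_zero hG hK hp hpk hpk' hpφ
  obtain ⟨w, hw0, hw, hw2⟩ := exists_eigenvector_blockU hφ hφ_zero hG (μ := μ) hk2 hkK
    (p := ⟨p, hp 0 (Set.mem_univ _)⟩) hpk hpk' hpφ
  set E := LinearMap.ker (Matrix.toLin' (jacobianZero φ).transpose - μ • LinearMap.id)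
  let S : E →ₗ[ℂ] germs n :=
    componentCombination hF0 ∘ₗ eigenvectorCoords (jacobianZero φ).transpose μ b
  -- `Ψ` embeds a space of dimension `dim E + 1` in `ker(U - μ)`, whose dimension is assumed to be
  -- `dim E`.
  let Ψ : E × ℂ →ₗ[ℂ] monomialSpan n G K :=
    (jet n G K ∘ₗ S).coprod (LinearMap.toSpanSingleton ℂ _ w)
  have hSker : ∀ x, blockU hG K (jet n G K (S x)) = μ • jet n G K (S x) := fun x => by
    rw [blockU_jet hφ hφ_zero hG, ← map_smul, ← sub_eq_zero, ← map_sub, jet_eq_zero_iff]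
    have := hF.germComp_componentCombination hφ hφ_zero hF0
      (eigenvectorCoords (jacobianZero φ).transpose μ b x) (K + 1)
    rwa [genEigenspaceMatrix_mulVec_eigenvectorCoords, map_smul] at this
  have hΨker : ∀ y, Ψ y ∈ LinearMap.ker ((blockU hG K).toLinearMap - μ • LinearMap.id) := by
    rintro ⟨x, c⟩
    refine sub_eq_zero.2 ?_
    change blockU hG K (jet n G K (S x) + c • w) = μ • (jet n G K (S x) + c • w)
    rw [map_add, map_smul, hSker, hw, smul_add, smul_comm]
  have hΨinj : Function.Injective Ψ := by
    rw [← LinearMap.ker_eq_bot, LinearMap.ker_eq_bot']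
    rintro ⟨x, c⟩ hxc
    have h1 : jet n G K (S x) + c • w = 0 := hxc
    -- A relation makes the jet of `S x` a multiple of `w`, so `S x` has no linear part and full
    -- rank forces `x = 0`.
    have h2 : S x ∈ vanishing n 2 := by
      rw [← toGerm_jet_mem_vanishing_iff (G := G) (K := K) (by omega), eq_neg_of_add_eq_zero_left h1]
      change toGerm n G (-(c • w.1)) ∈ _
      rw [map_neg, map_smul]
      exact Submodule.neg_mem _ (Submodule.smul_mem _ _ hw2)
    have h3 : x = 0 := eigenvectorCoords_injective _ _ b (by
      rw [map_zero]
      exact eq_zero_of_componentCombination_mem_vanishing hF0 hF.fullRank h2)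
    rw [h3, map_zero, map_zero, zero_add] at h1
    rw [h3, (smul_eq_zero.1 h1).resolve_right hw0]
    rfl
  have hle := LinearMap.finrank_le_finrank_of_injective
    (f := Ψ.codRestrict _ hΨker) (fun x y hxy => hΨinj (congrArg Subtype.val hxy))
  rw [hdim, Module.finrank_prod, Module.finrank_self] at hle
  omega
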